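/- \textbf{Setting.} Let $d\in\mathbb N$, let $H:\mathbb R^d\to\mathbb R$ be convex with $H(p)/|p|\to+\infty$ as $|p|\to\infty$, let $L(q)=\sup_{p\in\mathbb R^d}\{p\cdot q-H(p)\}$ be its Legendre transform, and let $g:\mathbb R^d\to\mathbb R$ be Lipschitz continuous and bounded. Let $\beta\in(0,1)$ and let $(D_\tau)_{\tau\ge 0}$ be a stable subordinator of order $\beta$ on a probability space $(\Omega,\mathcal F,\mathbb P)$, i.e. a nondecreasing real Lévy process with $\mathbb E[e^{-\lambda D_\tau}]=e^{-\tau\lambda^\beta}$ for all $\lambda,\tau\ge0$. Let $E_s=\inf\{\tau>0: D_\tau>s\}$, $s\ge 0$, be its inverse, and let $dE_s$ denote the Lebesgue--Stieltjes measure of the (a.s. nondecreasing) path $s\mapsto E_s$. \textbf{Control problem.} Fix $x\in\mathbb R^d$ and $t>0$, and let $(\mathcal F_s)_{s\ge0}$ be a filtration on $(\Omega,\mathcal F)$ such that $E_t$ is $\mathcal F_0$-measurable up to a $\mathbb P$-null set (for instance $\mathcal F_s=\mathcal F$ for all $s$, in which case the controls below are exactly the jointly measurable processes). Let $\mathcal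 A$ be the set of $\mathbb R^d$-valued processes $\alpha$ that are progressively measurable with respect to $(\mathcal F_s)$. For $\alpha\in\mathcal A$ such that a.s. $\int_{(0,t]}|\alpha(s)|\,dE_s<\infty$, let $X$ be the solution of $dX(s)=\alpha(s)\,dE_s$ on $(0,t]$, $X(t)=x$, that is, almost surely $X(s)=x-\int_{(s,t]}\alpha(r)\,dE_r$ for all $s\in[0,t]$, and let $$J_\beta(x,t,\alpha)=\mathbb E\Big[\int_{(0,t]}L(\alpha(s))\,dE_s+g(X(0))\Big]\in(-\infty,+\infty].$$ Let $u_\beta(x,t)$ be the infimum of $J_\beta(x,t,\alpha)$ over all such $\alpha$. \textbf{Proposition (Hopf--Lax formula).} Almost surely $E_t>0$ and the minimum $\min_{y\in\mathbb R^d}\{E_tL(\frac{x-y}{E_t})+g(y)\}$ is attained; it is an integrable random variable, and $$u_\beta(x,t)=\mathbb E\Big[\min_{y\in\mathbb R^d}\Big\{E_t\,L\Big(\frac{x-y}{E_t}\Big)+g(y)\Big\}\Big].$$ -/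

import Mathlib

open MeasureTheory ProbabilityTheory Filter Set
open scoped NNReal ENNReal Topology

noncomputable section

namespace TimeChanged

/-- The Legendre transform `L(q) = sup_p (p · q - H(p))`. For superlinear `H` bounded below on
bounded sets (in particular for convex superlinear `H`) the supremum is finite for every `q`. -/
def legendre {d : ℕ} (H : EuclideanSpace ℝ (Fin d) → ℝ) (q : EuclideanSpace ℝ (Fin d)) : ℝ :=
  ⨆ p : EuclideanSpace ℝ (Fin d), (inner ℝ p q - H p)

/-- `D` is a stable subordinator of order `β`: a real Lévy process, almost surely with
nondecreasing right-continuous paths (left limits then exist automatically), such that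
`E[exp (-l D_τ)] = exp (-τ l^β)` for all `l ≥ 0`. -/
structure IsStableSubordinator {Ω : Type*} [MeasurableSpace Ω] (β : ℝ) (D : ℝ≥0 → Ω → ℝ)
    (P : Measure Ω) : Prop where
  measurable : ∀ τ, Measurable (D τ)
  zero : ∀ᵐ ω ∂P, D 0 ω = 0
  monotone : ∀ᵐ ω ∂P, Monotone (fun τ => D τ ω)
  rightContinuous : ∀ᵐ ω ∂P, ∀ τ, ContinuousWithinAt (fun τ => D τ ω) (Ici τ) τ
  indepIncrements : HasIndepIncrements D P
  stationaryIncrements : ∀ σ τ : ℝ≥0, IdentDistrib (fun ω => D (σ + τ) ω - D σ ω) (D τ) P P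
  laplace : ∀ (τ : ℝ≥0) (l : ℝ), 0 ≤ l →
    ∫ ω, Real.exp (-(l * D τ ω)) ∂P = Real.exp (-((τ : ℝ) * l ^ β))

/-- The inverse process `E_t = inf {τ > 0 : D_τ > t}`. -/
def inverse {Ω : Type*} (D : ℝ≥0 → Ω → ℝ) (t : ℝ≥0) (ω : Ω) : ℝ :=
  ((sInf {τ : ℝ≥0 | 0 < τ ∧ (t : ℝ) < D τ ω} : ℝ≥0) : ℝ)

open scoped Classical in
/-- The Lebesgue-Stieltjes measure `df` on `[0, ∞)` of a nondecreasing function `f`; it gives mass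
`f b - f a` to `(a, b]` when `f` is continuous. The value `0` for other `f` is immaterial. -/
def stieltjes (f : ℝ≥0 → ℝ) : Measure ℝ≥0 :=
  if hf : Monotone f then hf.stieltjesFunction.measure else 0

/-- The measure `dE_s` on `[0, ∞)` for the outcome `ω`. -/
def clock {Ω : Type*} (D : ℝ≥0 → Ω → ℝ) (ω : Ω) : Measure ℝ≥0 :=
  stieltjes (fun s => inverse D s ω)

/-- The integral of an extended-real function, positive part minus negative part. It is only used
where the integral of the negative part is finite. -/
def extIntegral {S : Type*} [MeasurableSpace S] (μ : Measure S) (f : S → EReal) : EReal :=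
  ((∫⁻ s, (f s).toENNReal ∂μ : ℝ≥0∞) : EReal) - ((∫⁻ s, (-f s).toENNReal ∂μ : ℝ≥0∞) : EReal)

/-- `X` solves `dX(s) = α(s) dE_s` on `(0, t]` with `X(t) = x`, almost surely. -/
def IsTrajectory {Ω : Type*} [MeasurableSpace Ω] {d : ℕ} (P : Measure Ω) (D : ℝ≥0 → Ω → ℝ)
    (x : EuclideanSpace ℝ (Fin d)) (t : ℝ≥0) (α X : ℝ≥0 → Ω → EuclideanSpace ℝ (Fin d)) : Prop :=
  ∀ᵐ ω ∂P, IntegrableOn (fun s => α s ω) (Ioc 0 t) (clock D ω) ∧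
    ∀ s ≤ t, X s ω = x - ∫ r in Ioc s t, α r ω ∂(clock D ω)

/-- The cost `E[∫_{(0,t]} L(α(s)) dE_s + g(X(0))]`, possibly `+∞`. -/
def cost {Ω : Type*} [MeasurableSpace Ω] {d : ℕ} (P : Measure Ω) (D : ℝ≥0 → Ω → ℝ)
    (L g : EuclideanSpace ℝ (Fin d) → ℝ) (t : ℝ≥0)
    (α X : ℝ≥0 → Ω → EuclideanSpace ℝ (Fin d)) : EReal :=
  extIntegral P (fun ω =>
    extIntegral ((clock D ω).restrict (Ioc 0 t)) (fun s => ((L (α s ω) : ℝ) : EReal))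
      + ((g (X 0 ω) : ℝ) : EReal))

/-- The value function: the infimum of the cost over all progressively measurable controls `α`
for which the dynamics can be solved. -/
def valueFunction {Ω : Type*} [mΩ : MeasurableSpace Ω] {d : ℕ} (P : Measure Ω)
    (F : Filtration ℝ≥0 mΩ) (D : ℝ≥0 → Ω → ℝ) (L g : EuclideanSpace ℝ (Fin d) → ℝ)
    (x : EuclideanSpace ℝ (Fin d)) (t : ℝ≥0) : EReal :=
  ⨅ (α : ℝ≥0 → Ω → EuclideanSpace ℝ (Fin d)) (_ : IsStronglyProgressive F α)
    (X : ℝ≥0 → Ω → EuclideanSpace ℝ (Fin d)) (_ : IsTrajectory P D x t α X),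
    cost P D L g t α X

/-- The function `r L((x - y) / r) + g(y)` of `y`. -/
def hopfLax {d : ℕ} (L g : EuclideanSpace ℝ (Fin d) → ℝ) (x : EuclideanSpace ℝ (Fin d)) (r : ℝ)
    (y : EuclideanSpace ℝ (Fin d)) : ℝ :=
  r * L (r⁻¹ • (x - y)) + g y

end TimeChanged

end

/-!
# The Hopf-Lax formula for a control problem run by the inverse of a stable subordinator

For a fixed outcome the measure `dE_s` on `(0, t]` is a finite measure of total mass `E_t`, and the
trajectory depends on the control only through the integral of `α` against it. By Jensen's
inequality (`le_extIntegral_of_convexOn`) a control steering from `X 0 = y` to `x` pays at least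
`E_t L ((x - y) / E_t)`, with equality for the constant velocity `(x - y) / E_t`. Hence the cost of
every control dominates the expectation of the Hopf-Lax minimum (`le_cost_of_isTrajectory`).
Conversely, `E_t` is known at time `0`, so the constant velocity to `x` from a near-minimizer chosen
measurably in `E_t` (`exists_measurable_hopfLax_le`) is admissible, and it attains that expectation
up to an arbitrary error (`valueFunction_le_add`).

What is needed of the subordinator comes from its Laplace transform through the exponential
Chebyshev inequality `IsStableSubordinator.measureReal_le_le`. A large exponent shows that the paths
are positive at positive times, so that `E_0 = 0`. The exponent `1` makes the probabilities of
`D n ≤ t` summable in `n`, so that the paths are unbounded and `E_t` is integrable. Together with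
the right-continuity of `s ↦ E_s`, which holds for the inverse of any unbounded path, this gives the
mass `E_t` to `(0, t]` (`clock_Ioc`); strict monotonicity of `D` is not required. Right-continuity
of `D` at `0` gives `E_t > 0`.

The Legendre transform `L` is finite and convex, hence continuous, and grows at least linearly. As
`g` is continuous and bounded, minimizers exist, and the minimum is bounded by an affine function
of `E_t`, hence integrable.
-/

namespace TimeChanged

/-! ### The Legendre transform of a superlinear function -/

section Legendre

variable {d : ℕ} {H : EuclideanSpace ℝ (Fin d) → ℝ}

theorem bddAbove_range_legendre (hc : Continuous H)
    (hs : Tendsto (fun p => H p / ‖p‖) (Bornology.cobounded (EuclideanSpace ℝ (Fin d))) atTop)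
    (q : EuclideanSpace ℝ (Fin d)) :
    BddAbove (range fun p : EuclideanSpace ℝ (Fin d) => (inner ℝ p q - H p)) := by
  have hev : ∀ᶠ p in cocompact (EuclideanSpace ℝ (Fin d)), inner ℝ p q - H p ≤ 0 := by
    rw [← Metric.cobounded_eq_cocompact]
    filter_upwards [hs.eventually_ge_atTop ‖q‖,
      tendsto_norm_cobounded_atTop.eventually_gt_atTop (0 : ℝ)] with p hp hp0
    rw [le_div_iff₀ hp0] at hp
    nlinarith [real_inner_le_norm p q]
  obtain ⟨K, hK, hKs⟩ := mem_cocompact.1 hev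
  obtain ⟨c, hc'⟩ := hK.bddAbove_image (f := fun p => inner ℝ p q - H p) (by fun_prop)
  refine ⟨max c 0, ?_⟩
  rintro _ ⟨p, rfl⟩
  by_cases hp : p ∈ K
  · exact (hc' ⟨p, hp, rfl⟩).trans (le_max_left _ _)
  · exact (hKs hp).trans (le_max_right _ _)

theorem inner_sub_le_legendre (hc : Continuous H)
    (hs : Tendsto (fun p => H p / ‖p‖) (Bornology.cobounded (EuclideanSpace ℝ (Fin d))) atTop)
    (p q : EuclideanSpace ℝ (Fin d)) : inner ℝ p q - H p ≤ legendre H q :=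
  le_ciSup (bddAbove_range_legendre hc hs q) p

theorem convexOn_legendre (hc : Continuous H)
    (hs : Tendsto (fun p => H p / ‖p‖) (Bornology.cobounded (EuclideanSpace ℝ (Fin d))) atTop) :
    ConvexOn ℝ univ (legendre H) := by
  refine ⟨convex_univ, fun q₁ _ q₂ _ a b ha hb hab => ciSup_le fun p => ?_⟩
  have h₁ := mul_le_mul_of_nonneg_left (inner_sub_le_legendre hc hs p q₁) ha
  have h₂ := mul_le_mul_of_nonneg_left (inner_sub_le_legendre hc hs p q₂) hb
  rw [inner_add_right, inner_smul_right, inner_smul_right, smul_eq_mul, smul_eq_mul]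
  have : H p = a * H p + b * H p := by rw [← add_mul, hab, one_mul]
  linarith

/-- Only the unit ball of slopes is used, so the lower bound is linear; this is all the growth
that the existence of minimizers requires. -/
theorem exists_norm_sub_le_legendre (hc : Continuous H)
    (hs : Tendsto (fun p => H p / ‖p‖) (Bornology.cobounded (EuclideanSpace ℝ (Fin d))) atTop) :
    ∃ c : ℝ, ∀ q, ‖q‖ - c ≤ legendre H q := by
  obtain ⟨c, hc'⟩ := (isCompact_closedBall (0 : EuclideanSpace ℝ (Fin d)) 1).bddAbove_image
    hc.continuousOn
  refine ⟨c, fun q => ?_⟩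
  have hn : ‖(‖q‖⁻¹ • q)‖ ≤ 1 := by
    rw [norm_smul, norm_inv, norm_norm]
    exact inv_mul_le_one
  have hi : inner ℝ (‖q‖⁻¹ • q) q = ‖q‖ := by
    rw [real_inner_smul_left, real_inner_self_eq_norm_sq]
    rcases eq_or_ne ‖q‖ 0 with h | h
    · simp [h]
    · field_simp
  have := inner_sub_le_legendre hc hs (‖q‖⁻¹ • q) q
  have h' : H (‖q‖⁻¹ • q) ≤ c := hc' ⟨_, by simpa using hn, rfl⟩
  linarith

end Legendre

/-! ### Minimizers of the Hopf-Lax function -/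

section HopfLax

variable {d : ℕ} {L g : EuclideanSpace ℝ (Fin d) → ℝ} {C c r : ℝ} {x : EuclideanSpace ℝ (Fin d)}

theorem continuous_hopfLax (hL : Continuous L) (hg : Continuous g) (r : ℝ) :
    Continuous (hopfLax L g x r) := by
  unfold hopfLax
  fun_prop

theorem measurable_hopfLax (hL : Continuous L) (y : EuclideanSpace ℝ (Fin d)) :
    Measurable fun r => hopfLax L g x r y := by
  unfold hopfLax
  have := hL.measurable
  fun_prop

theorem le_hopfLax (hLc : ∀ q, ‖q‖ - c ≤ L q) (hgC : ∀ y, |g y| ≤ C) (hr : 0 < r)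
    (y : EuclideanSpace ℝ (Fin d)) : ‖x - y‖ - (r * c + C) ≤ hopfLax L g x r y := by
  have h := mul_le_mul_of_nonneg_left (hLc (r⁻¹ • (x - y))) hr.le
  have h' := (abs_le.1 (hgC y)).1
  rw [norm_smul, norm_inv, Real.norm_of_nonneg hr.le, mul_sub, mul_inv_cancel_left₀ hr.ne'] at h
  unfold hopfLax
  linarith

theorem bddBelow_hopfLax (hLc : ∀ q, ‖q‖ - c ≤ L q) (hgC : ∀ y, |g y| ≤ C) (hr : 0 < r) :
    BddBelow (range (hopfLax L g x r)) := by
  refine ⟨-(r * c + C), ?_⟩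
  rintro _ ⟨y, rfl⟩
  have := le_hopfLax (x := x) hLc hgC hr y
  have := norm_nonneg (x - y)
  linarith

theorem exists_forall_hopfLax_le (hL : Continuous L) (hg : Continuous g)
    (hLc : ∀ q, ‖q‖ - c ≤ L q) (hgC : ∀ y, |g y| ≤ C) (hr : 0 < r) :
    ∃ y₀, ∀ y, hopfLax L g x r y₀ ≤ hopfLax L g x r y := by
  refine (continuous_hopfLax hL hg r).exists_forall_le ?_
  refine tendsto_atTop_mono (fun y => le_hopfLax hLc hgC hr y) ?_
  refine tendsto_atTop_add_const_right _ _ ?_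
  rw [← Metric.cobounded_eq_cocompact]
  refine tendsto_atTop_mono (fun y => ?_)
    (tendsto_atTop_add_const_right _ (-‖x‖) tendsto_norm_cobounded_atTop)
  have := norm_sub_norm_le y x
  rw [norm_sub_rev] at this
  linarith

theorem abs_iInf_hopfLax_le (hLc : ∀ q, ‖q‖ - c ≤ L q) (hgC : ∀ y, |g y| ≤ C) (hr : 0 < r) :
    |⨅ y, hopfLax L g x r y| ≤ r * (|c| + |L 0|) + C := by
  rw [abs_le]
  have h₁ := mul_le_mul_of_nonneg_left (le_abs_self c) hr.le
  have h₂ := mul_le_mul_of_nonneg_left (le_abs_self (L 0)) hr.le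
  have h₃ := mul_nonneg hr.le (abs_nonneg c)
  have h₄ := mul_nonneg hr.le (abs_nonneg (L 0))
  constructor
  · refine le_ciInf fun y => ?_
    have := le_hopfLax (x := x) hLc hgC hr y
    have := norm_nonneg (x - y)
    linarith
  · refine (ciInf_le (bddBelow_hopfLax hLc hgC hr) x).trans ?_
    have := (abs_le.1 (hgC x)).2
    simp only [hopfLax, sub_self, smul_zero]
    linarith

theorem exists_hopfLax_denseSeq_lt (hL : Continuous L) (hg : Continuous g) (r : ℝ) {a : ℝ}
    (ha : ⨅ y, hopfLax L g x r y < a) :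
    ∃ k, hopfLax L g x r (TopologicalSpace.denseSeq _ k) < a := by
  obtain ⟨y, hy⟩ := exists_lt_of_ciInf_lt ha
  obtain ⟨k, hk⟩ := (TopologicalSpace.denseRange_denseSeq _).exists_mem_open
    (isOpen_Iio.preimage (continuous_hopfLax hL hg r)) ⟨y, hy⟩
  exact ⟨k, hk⟩

/-- The right side is a countable infimum, hence measurable in `r`. -/
theorem iInf_hopfLax_eq_iInf_denseSeq (hL : Continuous L) (hg : Continuous g)
    (hLc : ∀ q, ‖q‖ - c ≤ L q) (hgC : ∀ y, |g y| ≤ C) (hr : 0 < r) :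
    ⨅ y, hopfLax L g x r y = ⨅ k, hopfLax L g x r (TopologicalSpace.denseSeq _ k) := by
  have hb := bddBelow_hopfLax (x := x) hLc hgC hr
  refine le_antisymm (le_ciInf fun k => ciInf_le hb _) (le_of_forall_gt fun a ha => ?_)
  obtain ⟨k, hk⟩ := exists_hopfLax_denseSeq_lt hL hg r ha
  exact (ciInf_le (hb.mono (range_comp_subset_range _ _)) k).trans_lt hk

/-- Measurable selection of near-minimizers: the first good point of a dense sequence. -/
theorem exists_measurable_hopfLax_le (hL : Continuous L) (hg : Continuous g)
    (hLc : ∀ q, ‖q‖ - c ≤ L q) (hgC : ∀ y, |g y| ≤ C) (x : EuclideanSpace ℝ (Fin d))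
    {ε : ℝ} (hε : 0 < ε) :
    ∃ Y : ℝ → EuclideanSpace ℝ (Fin d), Measurable Y ∧
      ∀ r, 0 < r → hopfLax L g x r (Y r) ≤ (⨅ y, hopfLax L g x r y) + ε := by
  classical
  let y : ℕ → EuclideanSpace ℝ (Fin d) := TopologicalSpace.denseSeq _
  have hp : ∀ r : ℝ, ∃ k, hopfLax L g x r (y k) ≤ (⨅ k, hopfLax L g x r (y k)) + ε ∨ r ≤ 0 := by
    intro r
    rcases le_or_gt r 0 with hr | hr
    · exact ⟨0, Or.inr hr⟩
    · obtain ⟨k, hk⟩ := exists_hopfLax_denseSeq_lt (x := x) hL hg r (lt_add_of_pos_right _ hε)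
      rw [iInf_hopfLax_eq_iInf_denseSeq hL hg hLc hgC hr] at hk
      exact ⟨k, Or.inl hk.le⟩
  have hm : Measurable fun r : ℝ => Nat.find (hp r) := by
    refine measurable_find hp fun k => ?_
    refine (measurableSet_le (measurable_hopfLax hL _)
      ((Measurable.iInf fun k => measurable_hopfLax hL _).add_const ε)).union measurableSet_Iic
  refine ⟨fun r => y (Nat.find (hp r)), (measurable_of_countable y).comp hm, fun r hr => ?_⟩
  rw [iInf_hopfLax_eq_iInf_denseSeq hL hg hLc hgC hr]
  exact (Nat.find_spec (hp r)).resolve_right hr.not_ge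

end HopfLax

/-! ### Extended integrals and Jensen's inequality -/

section ExtIntegral

variable {S : Type*} [MeasurableSpace S] {μ : Measure S}

/-- No measurability is needed: both lower integrals are monotone, and the subtraction of
extended reals is monotone without exception. -/
theorem extIntegral_mono_ae {f h : S → EReal} (hfh : ∀ᵐ s ∂μ, f s ≤ h s) :
    extIntegral μ f ≤ extIntegral μ h := by
  refine EReal.sub_le_sub ?_ ?_
  · refine EReal.coe_ennreal_le_coe_ennreal_iff.2 (lintegral_mono_ae ?_)
    filter_upwards [hfh] with s hs using EReal.toENNReal_le_toENNReal hs
  · refine EReal.coe_ennreal_le_coe_ennreal_iff.2 (lintegral_mono_ae ?_)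
    filter_upwards [hfh] with s hs
    exact EReal.toENNReal_le_toENNReal (EReal.neg_le_neg_iff.2 hs)

theorem extIntegral_coe {f : S → ℝ} (hf : Integrable f μ) :
    extIntegral μ (fun s => (f s : EReal)) = ((∫ s, f s ∂μ : ℝ) : EReal) := by
  have h₁ : ∫⁻ s, ENNReal.ofReal (f s) ∂μ ≠ ∞ := hf.lintegral_lt_top.ne
  have h₂ : ∫⁻ s, ENNReal.ofReal (-f s) ∂μ ≠ ∞ := hf.neg.lintegral_lt_top.ne
  rw [integral_eq_lintegral_pos_part_sub_lintegral_neg_part hf, EReal.coe_sub]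
  simp only [extIntegral, ← EReal.coe_neg, EReal.real_coe_toENNReal]
  congr 1
  · rw [← EReal.coe_ennreal_toReal h₁]
  · rw [← EReal.coe_ennreal_toReal h₂]

/-- Jensen's inequality, including the case that the integral on the right is `+∞`. -/
theorem le_extIntegral_of_convexOn [IsFiniteMeasure μ] [NeZero μ] {E : Type*}
    [NormedAddCommGroup E] [NormedSpace ℝ E] [CompleteSpace E] {L : E → ℝ} {c : ℝ}
    (hconv : ConvexOn ℝ univ L) (hcont : Continuous L) (hc : ∀ q, -c ≤ L q) {f : S → E}
    (hf : Integrable f μ) :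
    ((μ.real univ * L ((μ.real univ)⁻¹ • ∫ s, f s ∂μ) : ℝ) : EReal) ≤
      extIntegral μ (fun s => ((L (f s) : ℝ) : EReal)) := by
  have hLf : AEStronglyMeasurable (fun s => L (f s)) μ :=
    hcont.comp_aestronglyMeasurable hf.aestronglyMeasurable
  by_cases hi : Integrable (fun s => L (f s)) μ
  · rw [extIntegral_coe hi, EReal.coe_le_coe_iff]
    have h := hconv.map_average_le hcont.continuousOn isClosed_univ (by simp) hf hi
    rw [average_eq, average_eq, smul_eq_mul] at h
    have hpos : 0 < μ.real univ := measureReal_univ_pos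
    rwa [← le_inv_mul_iff₀ hpos]
  · have hneg : ∫⁻ s, ENNReal.ofReal (-L (f s)) ∂μ ≠ ∞ := by
      refine ne_top_of_le_ne_top (b := ∫⁻ _, ENNReal.ofReal c ∂μ) ?_ (lintegral_mono fun s => ?_)
      · rw [lintegral_const]
        exact ENNReal.mul_ne_top ENNReal.ofReal_ne_top (measure_ne_top _ _)
      · exact ENNReal.ofReal_le_ofReal (by linarith [hc (f s)])
    have hpos : ∫⁻ s, ENNReal.ofReal (L (f s)) ∂μ = ∞ := by
      by_contra hne
      refine hi ⟨hLf, ?_⟩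
      rw [hasFiniteIntegral_iff_norm]
      have hfin := ENNReal.add_lt_top.2 ⟨Ne.lt_top hne, hneg.lt_top⟩
      rw [← lintegral_add_left' hLf.aemeasurable.ennreal_ofReal] at hfin
      refine lt_of_le_of_lt (lintegral_mono fun s => ?_) hfin
      rw [Real.norm_eq_abs]
      rcases le_total 0 (L (f s)) with h | h
      · rw [abs_of_nonneg h]
        exact le_self_add
      · rw [abs_of_nonpos h]
        exact le_add_self
    simp only [extIntegral, ← EReal.coe_neg, EReal.real_coe_toENNReal]
    rw [hpos, ← EReal.coe_ennreal_toReal hneg, EReal.coe_ennreal_top, EReal.top_sub_coe]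
    exact le_top

end ExtIntegral

/-! ### The inverse of an unbounded nondecreasing path -/

section Path

variable {Ω : Type*} {D : ℝ≥0 → Ω → ℝ} {ω : Ω}

theorem inverse_nonneg (D : ℝ≥0 → Ω → ℝ) (s : ℝ≥0) (ω : Ω) : 0 ≤ inverse D s ω :=
  NNReal.coe_nonneg _

theorem inverse_le {s τ : ℝ≥0} (hτ : 0 < τ) (h : (s : ℝ) < D τ ω) : inverse D s ω ≤ τ :=
  NNReal.coe_le_coe.2 (csInf_le (OrderBot.bddBelow _) ⟨hτ, h⟩)

/-- The path exceeds level `s` at some positive time smaller than any given `a` above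
`inverse D s ω`; unboundedness of the path excludes the value `sInf ∅ = 0`. -/
theorem exists_lt_of_inverse_lt (hunb : ∀ a : ℝ, ∃ τ : ℝ≥0, 0 < τ ∧ a < D τ ω) {s : ℝ≥0} {a : ℝ}
    (h : inverse D s ω < a) : ∃ τ : ℝ≥0, 0 < τ ∧ (s : ℝ) < D τ ω ∧ (τ : ℝ) < a := by
  have ha : 0 ≤ a := (inverse_nonneg D s ω).trans h.le
  lift a to ℝ≥0 using ha
  obtain ⟨τ, hτ, hlt⟩ := exists_lt_of_csInf_lt (hunb s) (NNReal.coe_lt_coe.1 h)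
  exact ⟨τ, hτ.1, hτ.2, NNReal.coe_lt_coe.2 hlt⟩

theorem monotone_inverse (hunb : ∀ a : ℝ, ∃ τ : ℝ≥0, 0 < τ ∧ a < D τ ω) :
    Monotone fun s => inverse D s ω := by
  intro s u hsu
  refine le_of_forall_gt fun a ha => ?_
  obtain ⟨τ, hτ, hD, hlt⟩ := exists_lt_of_inverse_lt hunb ha
  exact (inverse_le hτ ((NNReal.coe_le_coe.2 hsu).trans_lt hD)).trans_lt hlt

theorem continuousWithinAt_inverse (hunb : ∀ a : ℝ, ∃ τ : ℝ≥0, 0 < τ ∧ a < D τ ω) (s : ℝ≥0) :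
    ContinuousWithinAt (fun u => inverse D u ω) (Ici s) s := by
  refine tendsto_order.2 ⟨fun a ha => ?_, fun a ha => ?_⟩
  · filter_upwards [self_mem_nhdsWithin] with u hu
    exact ha.trans_le (monotone_inverse hunb hu)
  · obtain ⟨τ, hτ, hD, hlt⟩ := exists_lt_of_inverse_lt hunb ha
    have : ∀ᶠ u : ℝ≥0 in 𝓝 s, (u : ℝ) < D τ ω :=
      NNReal.continuous_coe.continuousAt.eventually_lt continuousAt_const hD
    filter_upwards [mem_nhdsWithin_of_mem_nhds this] with u hu
    exact (inverse_le hτ hu).trans_lt hlt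

theorem inverse_zero (hpos : ∀ τ : ℝ≥0, 0 < τ → 0 < D τ ω) : inverse D 0 ω = 0 := by
  refine le_antisymm (le_of_forall_gt fun a ha => ?_) (inverse_nonneg D 0 ω)
  obtain ⟨b, hb0, hba⟩ := exists_between ha
  lift b to ℝ≥0 using hb0.le
  exact (inverse_le (NNReal.coe_pos.1 hb0) (by simpa using hpos b hb0)).trans_lt hba

theorem inverse_pos (hunb : ∀ a : ℝ, ∃ τ : ℝ≥0, 0 < τ ∧ a < D τ ω)
    (hmono : Monotone fun τ => D τ ω) (h0 : D 0 ω = 0)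
    (hrc : ContinuousWithinAt (fun τ => D τ ω) (Ici 0) 0) {t : ℝ≥0} (ht : 0 < t) :
    0 < inverse D t ω := by
  have hc : Tendsto (fun τ => D τ ω) (𝓝 (0 : ℝ≥0)) (𝓝 0) := by
    have h := hrc
    rw [ContinuousWithinAt, h0, show Ici (0 : ℝ≥0) = univ from Ici_bot, nhdsWithin_univ] at h
    exact h
  have hev : ∀ᶠ τ in 𝓝[>] (0 : ℝ≥0), D τ ω < t :=
    mem_nhdsWithin_of_mem_nhds (hc.eventually_lt_const (by simpa using ht))
  obtain ⟨δ, hδ, hδ0⟩ := (hev.and self_mem_nhdsWithin).exists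
  refine lt_of_lt_of_le (NNReal.coe_pos.2 hδ0) (le_of_not_gt fun hlt => ?_)
  obtain ⟨τ, -, hD, hτ⟩ := exists_lt_of_inverse_lt hunb hlt
  exact absurd (hmono (NNReal.coe_lt_coe.1 hτ).le) (not_le.2 (hδ.trans hD))

/-- The clock gives `(0, t]` the mass `E_t - E_0` because `s ↦ E_s` is right-continuous; it is
`E_t` because the subordinator is positive at positive times. -/
theorem clock_Ioc (hunb : ∀ a : ℝ, ∃ τ : ℝ≥0, 0 < τ ∧ a < D τ ω)
    (hpos : ∀ τ : ℝ≥0, 0 < τ → 0 < D τ ω) (t : ℝ≥0) :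
    clock D ω (Ioc 0 t) = ENNReal.ofReal (inverse D t ω) := by
  have hm := monotone_inverse hunb
  have hval : ∀ s, hm.stieltjesFunction s = inverse D s ω := fun s => by
    rw [hm.stieltjesFunction_eq]
    exact (continuousWithinAt_inverse hunb s).rightLim_eq
  rw [clock, stieltjes, dif_pos hm, StieltjesFunction.measure_Ioc, hval, hval, inverse_zero hpos,
    sub_zero]

end Path

/-! ### Paths and tails of a stable subordinator -/

namespace IsStableSubordinator

variable {Ω : Type*} [MeasurableSpace Ω] {P : Measure Ω} {β : ℝ} {D : ℝ≥0 → Ω → ℝ}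

theorem ae_nonneg (hD : IsStableSubordinator β D P) (τ : ℝ≥0) : ∀ᵐ ω ∂P, 0 ≤ D τ ω := by
  filter_upwards [hD.zero, hD.monotone] with ω h0 hm
  exact h0.symm.le.trans (hm (zero_le (a := τ)))

variable [IsProbabilityMeasure P]

/-- The exponential Chebyshev inequality for the lower tail. -/
theorem measureReal_le_le (hD : IsStableSubordinator β D P) (τ : ℝ≥0) (s : ℝ) {l : ℝ}
    (hl : 0 ≤ l) : P.real {ω | D τ ω ≤ s} ≤ Real.exp (l * s - τ * l ^ β) := by
  have hint : Integrable (fun ω => Real.exp (-l * D τ ω)) P := by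
    refine Integrable.of_bound (by have := hD.measurable τ; fun_prop) 1 ?_
    filter_upwards [hD.ae_nonneg τ] with ω hω
    rw [Real.norm_of_nonneg (Real.exp_pos _).le, Real.exp_le_one_iff]
    nlinarith
  refine (measure_le_le_exp_mul_mgf s (neg_nonpos.2 hl) hint).trans_eq ?_
  have : mgf (D τ) P (-l) = Real.exp (-(τ * l ^ β)) := by
    simp only [mgf, neg_mul]
    exact hD.laplace τ l hl
  rw [this, ← Real.exp_add]
  ring_nf

/-- Letting `l → ∞` in the Laplace transform shows that `D τ` has no atom at `0`. -/
theorem ae_pos (hD : IsStableSubordinator β D P) (hβ : 0 < β) :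
    ∀ᵐ ω ∂P, ∀ τ : ℝ≥0, 0 < τ → 0 < D τ ω := by
  have h : ∀ τ : ℝ≥0, 0 < τ → ∀ᵐ ω ∂P, 0 < D τ ω := by
    intro τ hτ
    have hlim : Tendsto (fun l : ℝ => Real.exp (l * 0 - τ * l ^ β)) atTop (𝓝 0) := by
      simp only [mul_zero, zero_sub]
      exact Real.tendsto_exp_neg_atTop_nhds_zero.comp
        ((tendsto_rpow_atTop hβ).const_mul_atTop (NNReal.coe_pos.2 hτ))
    have hle : P.real {ω | D τ ω ≤ 0} ≤ 0 := by
      refine ge_of_tendsto hlim ?_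
      filter_upwards [eventually_ge_atTop (0 : ℝ)] with l hl using hD.measureReal_le_le τ 0 hl
    have hz : P {ω | D τ ω ≤ 0} = 0 :=
      (measureReal_eq_zero_iff).1 (le_antisymm hle measureReal_nonneg)
    simpa [ae_iff] using hz
  have h' : ∀ᵐ ω ∂P, ∀ n : ℕ, 0 < D (1 / ((n : ℝ≥0) + 1)) ω :=
    ae_all_iff.2 fun n => h _ (by positivity)
  filter_upwards [h', hD.monotone] with ω hω hm τ hτ
  obtain ⟨n, hn⟩ := exists_nat_one_div_lt hτ
  exact (hω n).trans_le (hm hn.le)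

theorem tsum_measure_le_ne_top (hD : IsStableSubordinator β D P) (s : ℝ) :
    ∑' n : ℕ, P {ω | D (n + 1) ω ≤ s} ≠ ∞ := by
  have hs : Summable fun n : ℕ => Real.exp (s - (n + 1)) := by
    have := Real.summable_exp_neg_nat.mul_left (Real.exp (s - 1))
    refine this.congr fun n => ?_
    rw [← Real.exp_add]
    ring_nf
  refine ne_top_of_le_ne_top hs.tsum_ofReal_ne_top (ENNReal.tsum_le_tsum fun n => ?_)
  rw [← ofReal_measureReal]
  refine ENNReal.ofReal_le_ofReal ((hD.measureReal_le_le _ s zero_le_one).trans_eq ?_)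
  simp

theorem ae_unbounded (hD : IsStableSubordinator β D P) :
    ∀ᵐ ω ∂P, ∀ a : ℝ, ∃ τ : ℝ≥0, 0 < τ ∧ a < D τ ω := by
  have h : ∀ᵐ ω ∂P, ∀ m : ℕ, ∀ᶠ n : ℕ in atTop, ω ∉ {ω | D (n + 1) ω ≤ m} :=
    ae_all_iff.2 fun m => ae_eventually_notMem (hD.tsum_measure_le_ne_top m)
  filter_upwards [h] with ω hω a
  obtain ⟨m, hm⟩ := exists_nat_ge a
  obtain ⟨n, hn⟩ := (hω m).exists
  exact ⟨n + 1, by positivity, hm.trans_lt (not_le.1 hn)⟩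

/-- The inverse is at most one plus the number of integer times at which the subordinator has
not yet passed `t`. -/
theorem lintegral_inverse_ne_top (hD : IsStableSubordinator β D P) (t : ℝ≥0) :
    ∫⁻ ω, ENNReal.ofReal (inverse D t ω) ∂P ≠ ∞ := by
  have hms : ∀ n : ℕ, MeasurableSet {ω | D (n + 1) ω ≤ t} := fun n =>
    measurableSet_le (hD.measurable _) measurable_const
  have hle : ∀ᵐ ω ∂P, ENNReal.ofReal (inverse D t ω) ≤
      1 + ∑' n : ℕ, {ω | D (n + 1) ω ≤ t}.indicator 1 ω := by
    filter_upwards [ae_eventually_notMem (hD.tsum_measure_le_ne_top t)] with ω hω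
    classical
    have hex : ∃ n : ℕ, (t : ℝ) < D (n + 1) ω := by
      obtain ⟨n, hn⟩ := hω.exists
      exact ⟨n, not_le.1 hn⟩
    have h₁ : inverse D t ω ≤ (Nat.find hex : ℝ) + 1 := by
      simpa using inverse_le (by positivity) (Nat.find_spec hex)
    have h₂ : (Nat.find hex : ℝ≥0∞) ≤ ∑' n : ℕ, {ω | D (n + 1) ω ≤ t}.indicator 1 ω := by
      refine le_trans (le_of_eq ?_) (ENNReal.sum_le_tsum (Finset.range (Nat.find hex)))
      have h₃ : ∀ n ∈ Finset.range (Nat.find hex),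
          {ω | D ((n : ℝ≥0) + 1) ω ≤ t}.indicator (1 : Ω → ℝ≥0∞) ω = 1 := fun n hn =>
        indicator_of_mem (show D ((n : ℝ≥0) + 1) ω ≤ t from
          not_lt.1 (Nat.find_min hex (Finset.mem_range.1 hn))) 1
      rw [Finset.sum_congr rfl h₃]
      simp
    calc ENNReal.ofReal (inverse D t ω) ≤ ENNReal.ofReal ((Nat.find hex : ℝ) + 1) :=
          ENNReal.ofReal_le_ofReal h₁
      _ = 1 + (Nat.find hex : ℝ≥0∞) := by
          rw [ENNReal.ofReal_add (by positivity) zero_le_one, ENNReal.ofReal_natCast,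
            ENNReal.ofReal_one, add_comm]
      _ ≤ _ := by gcongr
  refine ne_top_of_le_ne_top ?_ (lintegral_mono_ae hle)
  rw [lintegral_add_left measurable_const, lintegral_tsum fun n =>
    (measurable_one.indicator (hms n)).aemeasurable]
  simp only [lintegral_indicator_one (hms _)]
  simpa using hD.tsum_measure_le_ne_top t

end IsStableSubordinator

/-! ### Bounds for the value function -/

section ValueFunction

variable {Ω : Type*} [mΩ : MeasurableSpace Ω] {P : Measure Ω} {d : ℕ}
  {L g : EuclideanSpace ℝ (Fin d) → ℝ} {C c : ℝ} {D : ℝ≥0 → Ω → ℝ} {t : ℝ≥0}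
  {x : EuclideanSpace ℝ (Fin d)}

theorem aemeasurable_iInf_hopfLax (hL : Continuous L) (hg : Continuous g)
    (hLc : ∀ q, ‖q‖ - c ≤ L q) (hgC : ∀ y, |g y| ≤ C) (hEm : AEMeasurable (inverse D t) P)
    (hE : ∀ᵐ ω ∂P, 0 < inverse D t ω) :
    AEMeasurable (fun ω => ⨅ y, hopfLax L g x (inverse D t ω) y) P := by
  have hm : Measurable fun r => ⨅ k, hopfLax L g x r (TopologicalSpace.denseSeq _ k) :=
    Measurable.iInf fun k => measurable_hopfLax hL _
  refine (hm.comp_aemeasurable hEm).congr ?_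
  filter_upwards [hE] with ω hω
  exact (iInf_hopfLax_eq_iInf_denseSeq hL hg hLc hgC hω).symm

theorem integrable_iInf_hopfLax [IsFiniteMeasure P] (hL : Continuous L) (hg : Continuous g)
    (hLc : ∀ q, ‖q‖ - c ≤ L q) (hgC : ∀ y, |g y| ≤ C) (hEi : Integrable (inverse D t) P)
    (hE : ∀ᵐ ω ∂P, 0 < inverse D t ω) :
    Integrable (fun ω => ⨅ y, hopfLax L g x (inverse D t ω) y) P := by
  refine ((hEi.mul_const (|c| + |L 0|)).add (integrable_const C)).mono'
    (aemeasurable_iInf_hopfLax hL hg hLc hgC hEi.aemeasurable hE).aestronglyMeasurable ?_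
  filter_upwards [hE] with ω hω
  exact abs_iInf_hopfLax_le hLc hgC hω

/-- The lower bound: for almost every outcome, Jensen's inequality for the clock, whose mass on
`(0, t]` is `E_t`, bounds the running cost below by that of the constant velocity
`(x - X 0) / E_t`. -/
theorem le_cost_of_isTrajectory (hconv : ConvexOn ℝ univ L) (hL : Continuous L)
    (hLc : ∀ q, ‖q‖ - c ≤ L q) (hgC : ∀ y, |g y| ≤ C)
    (hE : ∀ᵐ ω ∂P, 0 < inverse D t ω)
    (hclock : ∀ᵐ ω ∂P, clock D ω (Ioc 0 t) = ENNReal.ofReal (inverse D t ω))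
    (hint : Integrable (fun ω => ⨅ y, hopfLax L g x (inverse D t ω) y) P)
    {α X : ℝ≥0 → Ω → EuclideanSpace ℝ (Fin d)} (hX : IsTrajectory P D x t α X) :
    ((∫ ω, ⨅ y, hopfLax L g x (inverse D t ω) y ∂P : ℝ) : EReal) ≤ cost P D L g t α X := by
  rw [← extIntegral_coe hint]
  refine extIntegral_mono_ae ?_
  filter_upwards [hE, hclock, hX] with ω hω hcl hXω
  obtain ⟨hα, hX⟩ := hXω
  have hfin : IsFiniteMeasure ((clock D ω).restrict (Ioc 0 t)) :=
    isFiniteMeasure_restrict.2 (by simp [hcl])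
  have hmass : ((clock D ω).restrict (Ioc 0 t)).real univ = inverse D t ω := by
    simp [measureReal_def, hcl, hω.le]
  have hne : NeZero ((clock D ω).restrict (Ioc 0 t)) := by
    refine ⟨fun h => hω.ne' ?_⟩
    rw [← hmass, h]
    simp
  have hJ := le_extIntegral_of_convexOn hconv hL
    (fun q => (by linarith [hLc q, norm_nonneg q] : -c ≤ L q)) hα
  have hx : ∫ s in Ioc 0 t, α s ω ∂(clock D ω) = x - X 0 ω := by
    rw [hX 0 (zero_le (a := t)), sub_sub_cancel]
  rw [hmass, hx] at hJ
  refine le_trans ?_ (add_le_add_left hJ _)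
  rw [← EReal.coe_add, EReal.coe_le_coe_iff]
  exact ciInf_le (bddBelow_hopfLax hLc hgC hω) (X 0 ω)

theorem isStronglyProgressive_const_time {F : Filtration ℝ≥0 mΩ} {E : Type*} [TopologicalSpace E]
    {a : Ω → E} (ha : StronglyMeasurable[F 0] a) :
    IsStronglyProgressive F (fun _ ω => a ω) := fun i =>
  StronglyMeasurable.comp_measurable (ha.mono (F.mono (zero_le (a := i))))
    (@measurable_snd _ _ _ (F i))

/-- The upper bound: run at the constant velocity from a near-minimizer for `E_t` to `x`. Since
`E_t` is known at time `0` up to a null set, this is an admissible control. -/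
theorem valueFunction_le_add [IsProbabilityMeasure P] {F : Filtration ℝ≥0 mΩ}
    (hL : Continuous L) (hg : Continuous g)
    (hLc : ∀ q, ‖q‖ - c ≤ L q) (hgC : ∀ y, |g y| ≤ C)
    (hF : AEStronglyMeasurable[F 0] (inverse D t) P)
    (hE : ∀ᵐ ω ∂P, 0 < inverse D t ω)
    (hclock : ∀ᵐ ω ∂P, clock D ω (Ioc 0 t) = ENNReal.ofReal (inverse D t ω))
    (hint : Integrable (fun ω => ⨅ y, hopfLax L g x (inverse D t ω) y) P)
    {ε : ℝ} (hε : 0 < ε) :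
    valueFunction P F D L g x t ≤
      ((∫ ω, ⨅ y, hopfLax L g x (inverse D t ω) y ∂P) + ε : ℝ) := by
  obtain ⟨Y, hY, hYle⟩ := exists_measurable_hopfLax_le hL hg hLc hgC x hε
  obtain ⟨e, he, hee⟩ := hF
  let v : ℝ → EuclideanSpace ℝ (Fin d) := fun r => r⁻¹ • (x - Y r)
  have hv : Measurable v := by fun_prop
  have ha : StronglyMeasurable[F 0] fun ω => v (e ω) :=
    (hv.comp he.measurable).stronglyMeasurable
  let α : ℝ≥0 → Ω → EuclideanSpace ℝ (Fin d) := fun _ ω => v (e ω)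
  let X : ℝ≥0 → Ω → EuclideanSpace ℝ (Fin d) :=
    fun s ω => x - ∫ r in Ioc s t, α r ω ∂(clock D ω)
  have hX : IsTrajectory P D x t α X := by
    filter_upwards [hclock] with ω hcl
    -- `α` is constant in time and the clock has finite mass on `(0, t]`.
    exact ⟨integrableOn_const (by rw [hcl]; exact ENNReal.ofReal_ne_top), fun s _ => rfl⟩
  refine (iInf₂_le_of_le α (isStronglyProgressive_const_time ha)
    (iInf₂_le_of_le X hX le_rfl)).trans ?_
  have hsum : (∫ ω, ⨅ y, hopfLax L g x (inverse D t ω) y ∂P) + ε =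
      ∫ ω, ((⨅ y, hopfLax L g x (inverse D t ω) y) + ε) ∂P := by
    rw [integral_add hint (integrable_const ε)]
    simp
  have hint' : Integrable (fun ω => (⨅ y, hopfLax L g x (inverse D t ω) y) + ε) P :=
    hint.add (integrable_const ε)
  rw [hsum, ← extIntegral_coe hint']
  refine extIntegral_mono_ae ?_
  filter_upwards [hE, hclock, hee] with ω hω hcl heω
  have hfin : IsFiniteMeasure ((clock D ω).restrict (Ioc 0 t)) :=
    isFiniteMeasure_restrict.2 (by simp [hcl])
  have hmass : ((clock D ω).restrict (Ioc 0 t)).real univ = inverse D t ω := by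
    simp [measureReal_def, hcl, hω.le]
  have hX0 : X 0 ω = Y (inverse D t ω) := by
    simp only [X, α, v, integral_const, hmass, ← heω]
    rw [smul_inv_smul₀ hω.ne', sub_sub_cancel]
  have hcost : extIntegral ((clock D ω).restrict (Ioc 0 t)) (fun s => ((L (α s ω) : ℝ) : EReal)) =
      ((∫ _, L (v (e ω)) ∂(clock D ω).restrict (Ioc 0 t) : ℝ) : EReal) :=
    extIntegral_coe (f := fun _ => L (v (e ω))) (integrable_const _)
  rw [hX0, hcost, integral_const, hmass, ← EReal.coe_add,
    EReal.coe_le_coe_iff, smul_eq_mul]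
  simp only [v, ← heω]
  exact hYle _ hω

end ValueFunction

end TimeChanged

theorem mainTheorem1 {Ω : Type*} [mΩ : MeasurableSpace Ω] (P : Measure Ω) [IsProbabilityMeasure P]
    {d : ℕ} (H g : EuclideanSpace ℝ (Fin d) → ℝ)
    (hHconv : ConvexOn ℝ univ H)
    (hHsuper : Tendsto (fun p => H p / ‖p‖) (Bornology.cobounded (EuclideanSpace ℝ (Fin d))) atTop)
    (hgLip : ∃ K : ℝ≥0, LipschitzWith K g)
    (hgBdd : ∃ C : ℝ, ∀ y, |g y| ≤ C)
    (β : ℝ) (hβ0 : 0 < β) (hβ1 : β < 1)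
    (D : ℝ≥0 → Ω → ℝ) (hD : TimeChanged.IsStableSubordinator β D P)
    (x : EuclideanSpace ℝ (Fin d)) (t : ℝ≥0) (ht : 0 < t)
    (F : Filtration ℝ≥0 mΩ)
    (hF : AEStronglyMeasurable[F 0] (TimeChanged.inverse D t) P) :
    (∀ᵐ ω ∂P, 0 < TimeChanged.inverse D t ω ∧
      ∃ y₀, ∀ y,
        TimeChanged.hopfLax (TimeChanged.legendre H) g x (TimeChanged.inverse D t ω) y₀ ≤
          TimeChanged.hopfLax (TimeChanged.legendre H) g x (TimeChanged.inverse D t ω) y) ∧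
    Integrable (fun ω =>
      ⨅ y, TimeChanged.hopfLax (TimeChanged.legendre H) g x (TimeChanged.inverse D t ω) y) P ∧
    TimeChanged.valueFunction P F D (TimeChanged.legendre H) g x t =
      ((∫ ω, ⨅ y, TimeChanged.hopfLax (TimeChanged.legendre H) g x
        (TimeChanged.inverse D t ω) y ∂P : ℝ) : EReal) := by
  obtain ⟨K, hK⟩ := hgLip
  obtain ⟨C, hgC⟩ := hgBdd
  have hg := hK.continuous
  have hH : Continuous H := hHconv.locallyLipschitz.continuous
  have hconv := TimeChanged.convexOn_legendre hH hHsuper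
  have hL : Continuous (TimeChanged.legendre H) := hconv.locallyLipschitz.continuous
  obtain ⟨c, hLc⟩ := TimeChanged.exists_norm_sub_le_legendre hH hHsuper
  have hE : ∀ᵐ ω ∂P, 0 < TimeChanged.inverse D t ω := by
    filter_upwards [hD.ae_unbounded, hD.monotone, hD.zero, hD.rightContinuous]
      with ω hunb hmono h0 hrc
    exact TimeChanged.inverse_pos hunb hmono h0 (hrc 0) ht
  have hclock : ∀ᵐ ω ∂P, TimeChanged.clock D ω (Ioc 0 t) =
      ENNReal.ofReal (TimeChanged.inverse D t ω) := by
    filter_upwards [hD.ae_unbounded, hD.ae_pos hβ0] with ω hunb hpos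
    exact TimeChanged.clock_Ioc hunb hpos t
  have hEi : Integrable (TimeChanged.inverse D t) P :=
    (lintegral_ofReal_ne_top_iff_integrable (hF.mono (F.le 0))
      (Eventually.of_forall (TimeChanged.inverse_nonneg D t))).1 (hD.lintegral_inverse_ne_top t)
  have hint := TimeChanged.integrable_iInf_hopfLax (x := x) hL hg hLc hgC hEi hE
  refine ⟨?_, hint, le_antisymm ?_ ?_⟩
  · filter_upwards [hE] with ω hω
    exact ⟨hω, TimeChanged.exists_forall_hopfLax_le hL hg hLc hgC hω⟩
  -- The upper bound holds with an error `ε > 0`, taken to be `z` minus the claimed value.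
  · refine EReal.le_of_forall_lt_iff_le.1 fun z hz => ?_
    have h := TimeChanged.valueFunction_le_add hL hg hLc hgC hF hE hclock hint
      (sub_pos.2 (EReal.coe_lt_coe_iff.1 hz))
    rwa [add_sub_cancel] at h
  · exact le_iInf₂ fun α _ => le_iInf₂ fun X hX =>
      TimeChanged.le_cost_of_isTrajectory hconv hL hLc hgC hE hclock hint hX
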